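/- Let $R$ be a commutative artinian ring and let $A$ be an Artin $R$-algebra, i.e. an $R$-algebra that is finitely generated as an $R$-module. Let $\mathrm{mod}\,A$ be the category of finitely generated right $A$-modules, and let $D=\mathrm{Hom}_R(-,J)$ be the standard duality, where $J$ is an injective envelope of $R/\mathrm{rad}\,R$; thus $DA$ is the dual of the left regular module, a right $A$-module. For $M\in\mathrm{mod}\,A$, let $\mathrm{add}\,M$, $\mathrm{Gen}\,M$ and $\mathrm{Cogen}\,M$ be the classes of all modules in $\mathrm{mod}\,A$ that are, respectively, direct summands, quotients and submodules (up to isomorphism) of finite direct sums $M^n$. Write $\mathrm{pd}$ and $\mathrm{id}$ for projective and injective dimension. Assume that $\mathrm{mod}\,A\neq\mathrm{add}(A\oplus DA)$. The algebra $A$ is called representation-hereditary if the global dimension of $\mathrm{End}_A(A\oplus DA)$ equals $3$. (i) Suppose that for every indecomposable $M\in\mathrm{mod}\,A$: - (b.1) if $\mathrm{Hom}_A(M,A)=0$, then $\mathrm{id}\,M\le 1$; - (b.2) if $\mathrm{pd}\,M\ge 2$, then $M\in\mathrm{add}\,DA$; - (b.3) if $\mathrm{Hom}_A(M,A)\neq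 0$ and $M\notin\mathrm{add}\,DA$, then $M\in\mathrm{Cogen}\,A$. Then $A$ is representation-hereditary. (ii) Suppose that for every indecomposable $M\in\mathrm{mod}\,A$: - (a.1) if $\mathrm{Hom}_A(DA,M)=0$, then $\mathrm{pd}\,M\le 1$; - (a.2) if $\mathrm{Hom}_A(DA,M)\neq 0$ and $M\notin\mathrm{add}\,A$, then $M\in\mathrm{Gen}\,DA$; - (a.3) if $\mathrm{id}\,M\ge 2$, then $M\in\mathrm{add}\,A$. Then $A$ is representation-hereditary. -/

import Mathlib

open CategoryTheory

universe u

namespace ArtinAlg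

/-! ### Injective envelopes -/

section Envelope

variable {S : Type u} [Ring S]

/-- The linear map `ι : M → E` is an injective envelope of `M`: the module `E` is injective, `ι` is
a monomorphism, and its image is essential, i.e. it meets every nonzero submodule of `E`
nontrivially. -/
structure IsInjectiveEnvelope {M E : Type u} [AddCommGroup M] [Module S M] [AddCommGroup E]
    [Module S E] (ι : M →ₗ[S] E) : Prop where
  injective_module : Module.Injective S E
  injective_map : Function.Injective ι
  essential : ∀ X : Submodule S E, X ⊓ LinearMap.range ι = ⊥ → X = ⊥

/-- Every submodule of an injective module has an injective envelope inside of that module. -/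
theorem exists_envelope_submodule {I : Type u} [AddCommGroup I] [Module S I]
    (hI : Module.Injective S I) (N : Submodule S I) :
    ∃ T : Submodule S I, N ≤ T ∧ (∀ X ≤ T, X ⊓ N = ⊥ → X = ⊥) ∧ Module.Injective S T := by
  obtain ⟨T, -, ⟨hNT, hess⟩, hTmax⟩ := zorn_le_nonempty₀
    {T : Submodule S I | N ≤ T ∧ ∀ X ≤ T, X ⊓ N = ⊥ → X = ⊥} (by
      intro c hc hchain y hy
      refine ⟨sSup c, ⟨(hc hy).1.trans (le_sSup hy), ?_⟩, fun z hz => le_sSup hz⟩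
      intro X hX hXN
      rw [Submodule.eq_bot_iff]
      intro x hx
      obtain ⟨T, hT, hxT⟩ := (Submodule.mem_sSup_of_directed ⟨y, hy⟩ hchain.directedOn).1 (hX hx)
      have h := (hc hT).2 (Submodule.span S {x}) (by simpa using hxT)
        (le_bot_iff.1 (hXN ▸ inf_le_inf_right N (by simpa using hx)))
      simpa using h) N ⟨le_rfl, fun X hX h => by rwa [inf_eq_left.2 hX] at h⟩
  refine ⟨T, hNT, hess, ?_⟩
  obtain ⟨C, hC⟩ := zorn_le₀ {C : Submodule S I | C ⊓ T = ⊥} (by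
      intro c hc hchain
      rcases c.eq_empty_or_nonempty with rfl | hne
      · exact ⟨⊥, by simp, by simp⟩
      refine ⟨sSup c, ?_, fun z hz => le_sSup hz⟩
      change sSup c ⊓ T = ⊥
      rw [Submodule.eq_bot_iff]
      rintro x ⟨hx, hxT⟩
      obtain ⟨D, hD, hxD⟩ := (Submodule.mem_sSup_of_directed hne hchain.directedOn).1 hx
      have h : D ⊓ T = ⊥ := hc hD
      exact (Submodule.eq_bot_iff _).1 h x ⟨hxD, hxT⟩)
  have hCT : C ⊓ T = ⊥ := hC.prop
  have hq : Function.Injective (C.mkQ ∘ₗ T.subtype) := by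
    rw [← LinearMap.ker_eq_bot, LinearMap.ker_eq_bot']
    intro t ht
    have h1 : (t : I) ∈ C := by simpa using ht
    exact Subtype.ext ((Submodule.eq_bot_iff _).1 hCT t ⟨h1, t.2⟩)
  obtain ⟨g, hg⟩ := hI.out (C.mkQ ∘ₗ T.subtype) hq T.subtype
  have hgT : ∀ t ∈ T, g (C.mkQ t) = t := fun t ht => hg ⟨t, ht⟩
  -- the kernel of `g`, pulled back to `I`, still meets `T` trivially
  have hker : LinearMap.ker (g ∘ₗ C.mkQ) ≤ C := by
    refine hC.le_of_ge (y := LinearMap.ker (g ∘ₗ C.mkQ)) ?_ ?_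
    · change LinearMap.ker (g ∘ₗ C.mkQ) ⊓ T = ⊥
      rw [Submodule.eq_bot_iff]
      rintro x ⟨hx, hxT⟩
      have h1 : g (C.mkQ x) = 0 := hx
      rwa [hgT x hxT] at h1
    · intro x hx
      have h1 : C.mkQ x = 0 := by simpa using hx
      simp only [LinearMap.mem_ker, LinearMap.comp_apply, h1, map_zero]
  -- the image of `g` is an essential extension of `N`
  have hrange : LinearMap.range (g ∘ₗ C.mkQ) ≤ T := by
    refine hTmax (y := LinearMap.range (g ∘ₗ C.mkQ)) ⟨?_, ?_⟩ ?_
    · intro x hx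
      exact ⟨x, hgT x (hNT hx)⟩
    · intro X hX hXN
      have hXT : X ⊓ T = ⊥ := by
        apply hess _ inf_le_right
        rw [inf_assoc, inf_eq_right.2 hNT, hXN]
      have hle : X.comap (g ∘ₗ C.mkQ) ≤ C := by
        refine hC.le_of_ge (y := X.comap (g ∘ₗ C.mkQ)) ?_ ?_
        · change X.comap (g ∘ₗ C.mkQ) ⊓ T = ⊥
          rw [Submodule.eq_bot_iff]
          rintro x ⟨hx, hxT⟩
          have h1 : g (C.mkQ x) ∈ X := hx
          rw [hgT x hxT] at h1
          exact (Submodule.eq_bot_iff _).1 hXT x ⟨h1, hxT⟩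
        · intro x hx
          have h1 : C.mkQ x = 0 := by simpa using hx
          simp only [Submodule.mem_comap, LinearMap.comp_apply, h1, map_zero, X.zero_mem]
      rw [Submodule.eq_bot_iff]
      intro x hx
      obtain ⟨y, rfl⟩ := hX hx
      have h1 : C.mkQ y = 0 := by simpa using hle hx
      rw [LinearMap.comp_apply, h1, map_zero]
    · intro x hx
      exact ⟨x, hgT x hx⟩
  refine ⟨fun X Y _ _ _ _ f hf h => ?_⟩
  obtain ⟨k, hk⟩ := hI.out f hf (T.subtype ∘ₗ h)
  refine ⟨(g ∘ₗ C.mkQ).codRestrict T (fun x => hrange ⟨x, rfl⟩) ∘ₗ k, fun x => ?_⟩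
  apply Subtype.ext
  simp only [LinearMap.comp_apply, LinearMap.codRestrict_apply, hk]
  exact hgT _ (h x).2

theorem exists_injectiveEnvelope (M : Type u) [AddCommGroup M] [Module S M] :
    ∃ (E : ModuleCat.{u} S) (ι : M →ₗ[S] E), IsInjectiveEnvelope ι := by
  obtain ⟨P⟩ := (inferInstance : EnoughInjectives (ModuleCat.{u} S)).presentation
    (ModuleCat.of S M)
  have hP : Module.Injective S P.J :=
    Module.injective_module_of_injective_object S P.J (inj := P.injective)
  have hf : Function.Injective P.f.hom := (ModuleCat.mono_iff_injective P.f).1 P.mono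
  obtain ⟨T, hNT, hess, hT⟩ := exists_envelope_submodule hP (LinearMap.range P.f.hom)
  refine ⟨ModuleCat.of S T, P.f.hom.codRestrict T (fun x => hNT ⟨x, rfl⟩), hT, ?_, ?_⟩
  · intro x y hxy
    exact hf (congrArg Subtype.val hxy)
  · intro X hX
    have h := hess (X.map T.subtype) (Submodule.map_subtype_le T X) (by
      rw [Submodule.eq_bot_iff]
      rintro _ ⟨⟨x, hx, rfl⟩, ⟨m, hm⟩⟩
      have := (Submodule.eq_bot_iff _).1 hX x ⟨hx, ⟨m, Subtype.ext hm⟩⟩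
      rw [this, map_zero])
    rw [Submodule.eq_bot_iff]
    intro x hx
    exact Subtype.ext ((Submodule.eq_bot_iff _).1 h x ⟨x, hx, rfl⟩)

/-- An injective envelope of the module `M` (it is unique up to isomorphism). -/
noncomputable def injectiveEnvelope (S : Type u) [Ring S] (M : Type u) [AddCommGroup M]
    [Module S M] : ModuleCat.{u} S :=
  (exists_injectiveEnvelope (S := S) M).choose

theorem injectiveEnvelope_spec (M : Type u) [AddCommGroup M] [Module S M] :
    ∃ ι : M →ₗ[S] injectiveEnvelope S M, IsInjectiveEnvelope ι :=
  (exists_injectiveEnvelope (S := S) M).choose_spec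

end Envelope

/-! ### Subcategories of modules over a ring -/

section Subcategories

variable {S : Type u} [Ring S]

/-- `N ∈ add M`: `N` is a direct summand of a finite direct sum of copies of `M`. -/
def InAdd (M N : Type u) [AddCommGroup M] [Module S M] [AddCommGroup N] [Module S N] : Prop :=
  ∃ (n : ℕ) (i : N →ₗ[S] (Fin n → M)) (p : (Fin n → M) →ₗ[S] N), p ∘ₗ i = LinearMap.id

/-- `N ∈ Gen M`: `N` is a quotient of a finite direct sum of copies of `M`. -/
def InGen (M N : Type u) [AddCommGroup M] [Module S M] [AddCommGroup N] [Module S N] : Prop :=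
  ∃ (n : ℕ) (p : (Fin n → M) →ₗ[S] N), Function.Surjective p

/-- `N ∈ Cogen M`: `N` embeds into a finite direct sum of copies of `M`. -/
def InCogen (M N : Type u) [AddCommGroup M] [Module S M] [AddCommGroup N] [Module S N] : Prop :=
  ∃ (n : ℕ) (i : N →ₗ[S] (Fin n → M)), Function.Injective i

/-- `M` is a finitely generated indecomposable (in particular nonzero) module. -/
def IsInd (M : ModuleCat.{u} S) : Prop :=
  Module.Finite S M ∧ Indecomposable M

/-- The global dimension: the supremum of the projective dimensions of all left modules. -/
noncomputable def globalDimension (S : Type u) [Ring S] : WithBot ℕ∞ :=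
  ⨆ M : ModuleCat.{u} S, projectiveDimension M

end Subcategories

/-! ### The dual of the regular module and representation-hereditary algebras

Right `A`-modules are modules over `Aᵐᵒᵖ`; with Mathlib's instance `A` is itself the regular right
module, `MulOpposite.op a • x = x * a`. -/

section Dual

variable (R A : Type u) [CommRing R] [Ring A] [Algebra R A]

/-- The module `D A = Hom_R(A, J)`, where `D = Hom_R(-, J)` is the standard duality and `J` is an
injective envelope of `R / rad R`. -/
def DA : Type u := A →ₗ[R] injectiveEnvelope R (R ⧸ Ring.jacobson R)

noncomputable instance : AddCommGroup (DA R A) :=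
  inferInstanceAs (AddCommGroup (A →ₗ[R] injectiveEnvelope R (R ⧸ Ring.jacobson R)))

/-- The right `A`-module structure of `D A`, induced by the left regular module:
`(f · a)(x) = f (a x)`. -/
noncomputable instance : Module Aᵐᵒᵖ (DA R A) where
  smul a f := LinearMap.comp (show A →ₗ[R] _ from f) (LinearMap.mulLeft R a.unop)
  one_smul f := LinearMap.ext fun x => congrArg (show A →ₗ[R] _ from f) (one_mul x)
  mul_smul a b f := LinearMap.ext fun x =>
    congrArg (show A →ₗ[R] _ from f) (mul_assoc b.unop a.unop x)
  smul_zero _ := LinearMap.ext fun _ => rfl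
  smul_add _ _ _ := LinearMap.ext fun _ => rfl
  add_smul a b f := LinearMap.ext fun x =>
    (congrArg (show A →ₗ[R] _ from f) (add_mul a.unop b.unop x)).trans (map_add _ _ _)
  zero_smul f := LinearMap.ext fun x =>
    (congrArg (show A →ₗ[R] _ from f) (zero_mul x)).trans (map_zero _)

/-- `A` is representation-hereditary: the endomorphism ring of the right `A`-module `A ⊕ DA` has
global dimension `3`, computed with right modules over `End_A(A ⊕ DA)`. -/
def IsRepresentationHereditary : Prop :=
  globalDimension (Module.End Aᵐᵒᵖ (A × DA R A))ᵐᵒᵖ = 3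

end Dual

end ArtinAlg

open ArtinAlg

/-! Put `G = A ⊕ DA` and `E = End(G)`. The functor `Hom(G, -)` is left exact and sends `add G` to
projective right `E`-modules, so homological questions over `E` become questions about `add
G`-approximations.

Upper bound. By Auslander's criterion only cyclic modules `E/I` matter. Since `E` is noetherian, `I`
is the image of `Hom(G, Gᵏ)` under composition with some `g : Gᵏ → G`, with kernel `Hom(G, ker g)`.
Hence it suffices that each `Hom(G, M)` has projective dimension at most 1, which holds if `M` has
an `add G`-approximation with kernel in `add G`; indecomposable `M` are enough.

Lower bound. Take `M` outside `add G` and an exact `0 → M → I₀ → I₁` with both `Iⱼ` in `add DA`. The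
cokernel of `Hom(G, I₀) → Hom(G, I₁)` has second syzygy `Hom(G, M)`, which is not projective because
`A` is a summand of `G`.

Approximations. Under (a), use a free cover of `M` if `Hom(DA, M) = 0`, and otherwise an `add
DA`-approximation, surjective as `M ∈ Gen DA`. Under (b), add a free cover to an `add
DA`-approximation. Let `N` be an indecomposable summand of the kernel in one of the last two cases.
If `id N ≤ 1` and the inclusion of `N` extends to an injective module containing `N`, lifting the
induced map from the cokernel to `M` gives a retraction, so `N ∈ add DA`. Otherwise (a) puts `N` in
`add A`; under (b), either `N ∈ add DA` or `N` embeds in some `Aᵐ`, and its inclusion into the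
kernel factors through a projective module. -/

namespace ArtinAlg

open Abelian Limits

/-! ### Reduction of global dimension to cyclic modules -/

section Auslander

variable {S : Type u} [Ring S]

theorem injective_of_ext_one_quotient_eq_zero (N : ModuleCat.{u} S)
    (h : ∀ (I : Ideal S) (e : Ext (ModuleCat.of S (S ⧸ I)) N 1), e = 0) : Injective N := by
  rw [← Module.injective_iff_injective_object, ← Module.Baer.iff_injective]
  intro I g
  have hI : (ShortComplex.mk (ModuleCat.ofHom I.subtype) (ModuleCat.ofHom I.mkQ)
      (by ext x; simp)).ShortExact :=
    ModuleCat.shortComplex_shortExact _ (LinearMap.exact_subtype_mkQ I)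
      I.injective_subtype I.mkQ_surjective
  obtain ⟨y, hy⟩ := Ext.contravariant_sequence_exact₁ hI N (Ext.mk₀ (ModuleCat.ofHom g))
    (add_zero 1) (h I _)
  obtain ⟨y, rfl⟩ := Ext.homEquiv₀.symm.surjective y
  rw [Ext.homEquiv₀_symm_apply, Ext.mk₀_comp_mk₀] at hy
  have hy' := (Ext.mk₀_bijective _ _).1 hy
  refine ⟨y.hom, fun x hx => ?_⟩
  exact congr($(hy').hom ⟨x, hx⟩)

/-- Dimension shifting into an injective module reduces to `n = 0`, which is Baer's criterion. -/
theorem hasInjectiveDimensionLT_of_ext_quotient_eq_zero (n : ℕ) (N : ModuleCat.{u} S)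
    (h : ∀ (I : Ideal S) (e : Ext (ModuleCat.of S (S ⧸ I)) N (n + 1)), e = 0) :
    HasInjectiveDimensionLT N (n + 1) := by
  induction n generalizing N with
  | zero =>
    have := injective_of_ext_one_quotient_eq_zero N h
    infer_instance
  | succ n ih =>
    let p := (EnoughInjectives.presentation N).some
    have hp : (ShortComplex.mk _ _ (cokernel.condition p.f)).ShortExact :=
      { exact := ShortComplex.exact_cokernel p.f }
    have : HasInjectiveDimensionLT (cokernel p.f) (n + 1) := by
      refine ih _ fun I e => ?_
      obtain ⟨y, hy⟩ := Ext.covariant_sequence_exact₃ (ModuleCat.of S (S ⧸ I)) hp e rfl (h I _)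
      rw [← hy, Ext.eq_zero_of_injective y, Ext.zero_comp]
    exact hp.hasInjectiveDimensionLT_X₁ (n + 1) this inferInstance

/-- Auslander's criterion: projective dimensions are bounded by those of the cyclic modules. -/
theorem hasProjectiveDimensionLE_of_quotient (n : ℕ)
    (h : ∀ I : Ideal S, HasProjectiveDimensionLE (ModuleCat.of S (S ⧸ I)) n)
    (X : ModuleCat.{u} S) : HasProjectiveDimensionLE X n := by
  refine HasProjectiveDimensionLT.mk fun i hi N e => ?_
  have := hasInjectiveDimensionLT_of_ext_quotient_eq_zero n N
    fun I e => have := h I; e.eq_zero_of_hasProjectiveDimensionLT (n + 1) le_rfl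
  exact e.eq_zero_of_hasInjectiveDimensionLT (n + 1) hi

end Auslander

/-! ### Closure properties of `add M` -/

section InAdd

variable {S : Type u} [Ring S] {M M' N L : Type u} [AddCommGroup M] [Module S M]
  [AddCommGroup M'] [Module S M'] [AddCommGroup N] [Module S N] [AddCommGroup L] [Module S L]

theorem InAdd.of_retract (h : InAdd (S := S) M N) (s : L →ₗ[S] N) (r : N →ₗ[S] L)
    (hrs : r ∘ₗ s = LinearMap.id) : InAdd (S := S) M L := by
  obtain ⟨n, i, p, hp⟩ := h
  refine ⟨n, i ∘ₗ s, r ∘ₗ p, ?_⟩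
  rw [LinearMap.comp_assoc, ← LinearMap.comp_assoc s i p, hp, LinearMap.id_comp, hrs]

theorem InAdd.of_fintype {ι : Type*} [Fintype ι] (s : L →ₗ[S] (ι → M)) (r : (ι → M) →ₗ[S] L)
    (hrs : r ∘ₗ s = LinearMap.id) : InAdd (S := S) M L := by
  let e : (ι → M) ≃ₗ[S] (Fin (Fintype.card ι) → M) :=
    LinearEquiv.funCongrLeft S M (Fintype.equivFin ι).symm
  refine ⟨_, e ∘ₗ s, r ∘ₗ e.symm.toLinearMap, ?_⟩
  ext x
  simpa using congr($hrs x)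

theorem inAdd_pi (ι : Type*) [Fintype ι] (f : (ι → M) ≃ₗ[S] N) : InAdd (S := S) M N :=
  InAdd.of_fintype f.symm.toLinearMap f.toLinearMap (by ext; simp)

theorem inAdd_of_subsingleton [Subsingleton L] : InAdd (S := S) M L :=
  ⟨0, 0, 0, Subsingleton.elim _ _⟩

theorem InAdd.prod (h : InAdd (S := S) M N) (h' : InAdd (S := S) M L) :
    InAdd (S := S) M (N × L) := by
  obtain ⟨n, i, p, hp⟩ := h
  obtain ⟨m, j, q, hq⟩ := h'
  let e := LinearEquiv.sumArrowLequivProdArrow (Fin n) (Fin m) S M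
  refine InAdd.of_fintype (e.symm ∘ₗ i.prodMap j) (p.prodMap q ∘ₗ e.toLinearMap) ?_
  refine LinearMap.ext fun x => ?_
  have h1 := fun x => congr($hp x)
  have h2 := fun x => congr($hq x)
  simp only [LinearMap.comp_apply, LinearMap.id_apply] at h1 h2
  ext <;> simp [h1, h2]

/-- A retract of `M'` generates at most what `M'` generates. -/
theorem InAdd.mono (h : InAdd (S := S) M N) (s : M →ₗ[S] M') (r : M' →ₗ[S] M)
    (hrs : r ∘ₗ s = LinearMap.id) : InAdd (S := S) M' N := by
  obtain ⟨n, i, p, hp⟩ := h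
  refine ⟨n, s.compLeft (Fin n) ∘ₗ i, p ∘ₗ r.compLeft (Fin n), ?_⟩
  have h1 : r.compLeft (Fin n) ∘ₗ s.compLeft (Fin n) = LinearMap.id := by
    refine LinearMap.ext fun x => funext fun k => ?_
    exact congr($hrs (x k))
  rw [LinearMap.comp_assoc, ← LinearMap.comp_assoc _ _ (r.compLeft (Fin n)), h1,
    LinearMap.id_comp, hp]

theorem InAdd.prod_left (h : InAdd (S := S) M N) : InAdd (S := S) (M × M') N :=
  h.mono (LinearMap.inl S M M') (LinearMap.fst S M M') (by ext; rfl)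

theorem InAdd.prod_right (h : InAdd (S := S) M N) : InAdd (S := S) (M' × M) N :=
  h.mono (LinearMap.inr S M' M) (LinearMap.snd S M' M) (by ext; rfl)

theorem InAdd.of_equiv (h : InAdd (S := S) M N) (e : M ≃ₗ[S] M') : InAdd (S := S) M' N :=
  h.mono e.toLinearMap e.symm.toLinearMap (by ext; simp)

theorem InAdd.finite [Module.Finite S M] (h : InAdd (S := S) M N) : Module.Finite S N := by
  obtain ⟨n, i, p, hp⟩ := h
  exact Module.Finite.of_surjective p fun x => ⟨i x, congr($hp x)⟩

theorem InAdd.injective (hM : Module.Injective S M) (h : InAdd (S := S) M N) :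
    Module.Injective S N := by
  obtain ⟨n, i, p, hp⟩ := h
  refine ⟨fun X Y _ _ _ _ f hf g => ?_⟩
  choose k hk using fun j : Fin n => hM.out f hf (LinearMap.proj j ∘ₗ i ∘ₗ g)
  refine ⟨p ∘ₗ LinearMap.pi k, fun x => ?_⟩
  have : LinearMap.pi k (f x) = i (g x) := funext fun j => hk j x
  rw [LinearMap.comp_apply, this]
  exact congr($hp (g x))

/-- Lifting along `p` passes from `M` to `add M`. -/
theorem InAdd.exists_lift {X Y : Type u} [AddCommGroup X] [Module S X] [AddCommGroup Y]
    [Module S Y] (p : X →ₗ[S] Y) (hp : ∀ g : M →ₗ[S] Y, ∃ h : M →ₗ[S] X, p ∘ₗ h = g)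
    (hN : InAdd (S := S) M N) (g : N →ₗ[S] Y) : ∃ h : N →ₗ[S] X, p ∘ₗ h = g := by
  obtain ⟨n, i, q, hq⟩ := hN
  choose k hk using fun j : Fin n => hp (g ∘ₗ q ∘ₗ LinearMap.single S (fun _ => M) j)
  refine ⟨LinearMap.lsum S (fun _ => M) ℕ k ∘ₗ i, ?_⟩
  have h1 : p ∘ₗ LinearMap.lsum S (fun _ => M) ℕ k = g ∘ₗ q := by
    refine LinearMap.pi_ext' fun j => ?_
    refine LinearMap.ext fun x => ?_
    rw [LinearMap.comp_apply, LinearMap.comp_apply, LinearMap.comp_apply,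
      LinearMap.coe_single, LinearMap.lsum_piSingle]
    exact congr($(hk j) x)
  rw [← LinearMap.comp_assoc, h1, LinearMap.comp_assoc, hq, LinearMap.comp_id]

theorem inAdd_of_projective [Module.Finite S N] [Module.Projective S N] : InAdd (S := S) S N := by
  obtain ⟨n, f, hf⟩ := Module.Finite.exists_fin' S N
  obtain ⟨g, hg⟩ := Module.projective_lifting_property f LinearMap.id hf
  exact ⟨n, g, f, hg⟩

theorem inAdd_of_injective (hN : Module.Injective S N) (h : InCogen (S := S) M N) :
    InAdd (S := S) M N := by
  obtain ⟨n, i, hi⟩ := h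
  obtain ⟨p, hp⟩ := hN.out i hi LinearMap.id
  exact ⟨n, i, p, LinearMap.ext hp⟩

end InAdd

/-! ### The functor `Hom(G, -)` and projective modules over `End(G)` -/

section HomMod

variable {S : Type u} [Ring S] (G : Type u) [AddCommGroup G] [Module S G]
variable {M N L : Type u} [AddCommGroup M] [Module S M] [AddCommGroup N] [Module S N]
  [AddCommGroup L] [Module S L]

/-- `Hom(G, M)` as a right module over the endomorphism ring of `G`. -/
def HomMod (M : Type u) [AddCommGroup M] [Module S M] : Type u := G →ₗ[S] M

instance : AddCommGroup (HomMod (S := S) G M) := inferInstanceAs (AddCommGroup (G →ₗ[S] M))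

instance : Module (Module.End S G)ᵐᵒᵖ (HomMod (S := S) G M) where
  smul e f := (show G →ₗ[S] M from f) ∘ₗ e.unop
  one_smul _ := rfl
  mul_smul _ _ _ := rfl
  smul_zero _ := rfl
  smul_add _ _ _ := rfl
  add_smul e e' f := LinearMap.comp_add e.unop e'.unop (show G →ₗ[S] M from f)
  zero_smul f := LinearMap.comp_zero (show G →ₗ[S] M from f)

/-- The functor `Hom(G, -)` on morphisms. -/
def HomMod.map (f : M →ₗ[S] N) :
    HomMod (S := S) G M →ₗ[(Module.End S G)ᵐᵒᵖ] HomMod (S := S) G N where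
  toFun g := f ∘ₗ (show G →ₗ[S] M from g)
  map_add' _ _ := LinearMap.comp_add _ _ f
  map_smul' _ _ := rfl

theorem HomMod.map_comp (f : M →ₗ[S] N) (g : N →ₗ[S] L) :
    HomMod.map G (g ∘ₗ f) = HomMod.map G g ∘ₗ HomMod.map G f := rfl

theorem HomMod.map_id :
    HomMod.map G (LinearMap.id : M →ₗ[S] M) = LinearMap.id := rfl

/-- `Hom(G, Gⁿ)` is free. -/
def HomMod.piEquiv (n : ℕ) :
    HomMod (S := S) G (Fin n → G) ≃ₗ[(Module.End S G)ᵐᵒᵖ] (Fin n → (Module.End S G)ᵐᵒᵖ) where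
  toFun f j := MulOpposite.op (LinearMap.proj j ∘ₗ (show G →ₗ[S] (Fin n → G) from f))
  invFun g := LinearMap.pi fun j => (g j).unop
  map_add' _ _ := rfl
  map_smul' _ _ := rfl
  left_inv _ := rfl
  right_inv _ := rfl

theorem HomMod.projective (h : InAdd (S := S) G M) :
    Module.Projective (Module.End S G)ᵐᵒᵖ (HomMod (S := S) G M) := by
  obtain ⟨n, i, p, hp⟩ := h
  have := Module.Projective.of_equiv (HomMod.piEquiv (S := S) G n).symm
  exact Module.Projective.of_split (HomMod.map G i) (HomMod.map G p)
    (by rw [← HomMod.map_comp, hp, HomMod.map_id])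

/-- If `S` is a summand of `G`, then `Hom(G, M)` is projective only for `M` in `add G`. -/
theorem inAdd_of_homMod_projective (i : S →ₗ[S] G) (q : G →ₗ[S] S) (hq : q ∘ₗ i = LinearMap.id)
    (hM : Module.Projective (Module.End S G)ᵐᵒᵖ (HomMod (S := S) G M))
    {k : ℕ} (f : (Fin k → G) →ₗ[S] M) (hf : Function.Surjective (HomMod.map G f)) :
    InAdd (S := S) G M := by
  obtain ⟨σ, hσ⟩ := Module.projective_lifting_property (HomMod.map G f) LinearMap.id hf
  have hqi : ∀ a, q (i a) = a := fun a => congr($hq a)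
  -- `ρ` identifies `M = Hom(S, M)` with the maps `G → M` factoring through `q`; `ev` goes back by
  -- evaluating at `i 1`. Multiplication by `a` on `S` is realised by an endomorphism of `G`, so
  -- linearity of `σ` over `End(G)` makes `ev ∘ σ ∘ ρ` linear over `S`.
  let ρ : M → HomMod (S := S) G M := fun m => LinearMap.toSpanSingleton S M m ∘ₗ q
  let ev : HomMod (S := S) G (Fin k → G) → (Fin k → G) :=
    fun g => (show G →ₗ[S] (Fin k → G) from g) (i 1)
  have hρs : ∀ (a : S) (m : M), ρ (a • m) =
      MulOpposite.op (i ∘ₗ LinearMap.toSpanSingleton S S a ∘ₗ q) • ρ m := fun a m =>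
    LinearMap.ext fun x => by
      change q x • a • m = q (i (q x • a)) • m
      rw [hqi, smul_eq_mul, mul_smul]
  have hρa : ∀ m m' : M, ρ (m + m') = ρ m + ρ m' := fun m m' =>
    LinearMap.ext fun x => smul_add (q x) m m'
  let s : M →ₗ[S] (Fin k → G) :=
    { toFun := fun m => ev (σ (ρ m))
      map_add' := fun m m' => by
        rw [hρa, map_add]
        rfl
      map_smul' := fun a m => by
        rw [hρs, map_smul]
        change (show G →ₗ[S] (Fin k → G) from σ (ρ m)) (i (q (i 1) • a)) = _
        rw [hqi, one_smul, RingHom.id_apply]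
        change _ = a • (show G →ₗ[S] (Fin k → G) from σ (ρ m)) (i 1)
        rw [← map_smul, ← map_smul, smul_eq_mul, mul_one] }
  refine ⟨k, s, f, LinearMap.ext fun m => ?_⟩
  have h1 : HomMod.map G f (σ (ρ m)) = ρ m := congr($hσ (ρ m))
  have h2 : (show G →ₗ[S] M from HomMod.map G f (σ (ρ m))) (i 1) =
    (show G →ₗ[S] M from ρ m) (i 1) := by rw [h1]
  refine h2.trans ?_
  change q (i 1) • m = m
  rw [hqi, one_smul]

end HomMod

/-! ### Decomposition into indecomposables -/

section Decomposition

variable {S : Type u} [Ring S]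

/-- Induction along decompositions of finitely generated modules into indecomposables. -/
theorem induction_on_indecomposables [IsArtinianRing S] [IsNoetherianRing S]
    {Q : ModuleCat.{u} S → Prop}
    (zero : ∀ M : ModuleCat.{u} S, Subsingleton M → Q M)
    (ind : ∀ M : ModuleCat.{u} S, IsInd M → Q M)
    (prod : ∀ M Y Z : ModuleCat.{u} S, (M ≃ₗ[S] Y × Z) → Q Y → Q Z → Q M)
    (M : ModuleCat.{u} S) (hM : Module.Finite S M) : Q M := by
  -- Lengths are finite, so both factors of a nontrivial decomposition are strictly shorter.
  generalize hl : Module.length S M = l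
  induction l using WellFoundedLT.induction generalizing M with
  | ind l ih =>
  subst hl
  by_cases h0 : Limits.IsZero M
  · exact zero M (ModuleCat.isZero_iff_subsingleton.1 h0)
  by_cases hind : Indecomposable M
  · exact ind M ⟨hM, hind⟩
  simp only [Indecomposable, not_and, not_forall, not_or] at hind
  obtain ⟨Y, Z, e, hY, hZ⟩ := hind h0
  let e' : M ≃ₗ[S] Y × Z := (e ≪≫ ModuleCat.biprodIsoProd Y Z).toLinearEquiv
  have hYZ : Module.Finite S (Y × Z) := Module.Finite.equiv e'
  have hYf : Module.Finite S Y :=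
    Module.Finite.of_surjective (LinearMap.fst S Y Z) LinearMap.fst_surjective
  have hZf : Module.Finite S Z :=
    Module.Finite.of_surjective (LinearMap.snd S Y Z) LinearMap.snd_surjective
  have hlen : Module.length S M = Module.length S Y + Module.length S Z := by
    rw [e'.length_eq, Module.length_prod]
  rw [ModuleCat.isZero_iff_subsingleton, not_subsingleton_iff_nontrivial,
    ← Module.length_pos_iff (R := S)] at hY hZ
  have hYt := Module.length_ne_top (R := S) (M := Y)
  have hZt := Module.length_ne_top (R := S) (M := Z)
  refine prod M Y Z e' (ih _ ?_ Y hYf rfl) (ih _ ?_ Z hZf rfl) <;> rw [hlen]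
  · rw [add_comm]
    exact ENat.lt_add_left hYt hZ
  · exact ENat.lt_add_left hZt hY

/-- To be in `add G` can be checked on the indecomposable summands. -/
theorem inAdd_of_indecomposable_retracts [IsArtinianRing S] [IsNoetherianRing S]
    {G : Type u} [AddCommGroup G] [Module S G] {K : Type u} [AddCommGroup K] [Module S K]
    [Module.Finite S K]
    (h : ∀ N : ModuleCat.{u} S, IsInd N → ∀ (s : N →ₗ[S] K) (r : K →ₗ[S] N),
      r ∘ₗ s = LinearMap.id → InAdd (S := S) G N) : InAdd (S := S) G K := by
  refine induction_on_indecomposables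
    (Q := fun N => ∀ (s : N →ₗ[S] K) (r : K →ₗ[S] N), r ∘ₗ s = LinearMap.id →
      InAdd (S := S) G N) ?_ h ?_ (ModuleCat.of S K) inferInstance LinearMap.id LinearMap.id rfl
  · intro M _ s r _
    exact inAdd_of_subsingleton
  · intro M Y Z e hY hZ s r hrs
    have hrs' : ∀ x, r (s x) = x := fun x => congr($hrs x)
    refine ((hY (s ∘ₗ e.symm.toLinearMap ∘ₗ LinearMap.inl S Y Z)
      (LinearMap.fst S Y Z ∘ₗ e.toLinearMap ∘ₗ r) ?_).prod
      (hZ (s ∘ₗ e.symm.toLinearMap ∘ₗ LinearMap.inr S Y Z)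
      (LinearMap.snd S Y Z ∘ₗ e.toLinearMap ∘ₗ r) ?_)).of_retract e.toLinearMap
      e.symm.toLinearMap ?_
    all_goals
      refine LinearMap.ext fun x => ?_
      simp [hrs']

end Decomposition

/-! ### Bounds for the global dimension of `End(G)` -/

section GlobalDimension

variable {S : Type u} [Ring S] {G : Type u} [AddCommGroup G] [Module S G]
variable {K X M : Type u} [AddCommGroup K] [Module S K] [AddCommGroup X] [Module S X]
  [AddCommGroup M] [Module S M]

variable (G) in
theorem HomMod.map_injective (f : K →ₗ[S] X) (hf : Function.Injective f) :
    Function.Injective (HomMod.map G f) := fun (x : G →ₗ[S] K) (y : G →ₗ[S] K) hxy =>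
  LinearMap.ext fun t => hf (LinearMap.congr_fun (f := f ∘ₗ x) (g := f ∘ₗ y) hxy t)

variable (G) in
theorem HomMod.map_exact (f : K →ₗ[S] X) (g : X →ₗ[S] M) (hf : Function.Injective f)
    (hfg : Function.Exact f g) : Function.Exact (HomMod.map G f) (HomMod.map G g) := by
  intro (y : G →ₗ[S] X)
  constructor
  · intro hy
    have hy' : ∀ x, g (y x) = 0 := fun x => LinearMap.congr_fun (f := g ∘ₗ y) (g := 0) hy x
    refine ⟨((LinearEquiv.ofInjective f hf).symm.toLinearMap ∘ₗ
      y.codRestrict (LinearMap.range f) (fun x => (hfg (y x)).1 (hy' x)) : G →ₗ[S] K), ?_⟩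
    exact LinearMap.ext fun x => LinearEquiv.ofInjective_symm_apply (f := f) (h := hf) _
  · rintro ⟨x, rfl⟩
    exact LinearMap.ext fun t => hfg.apply_apply_eq_zero ((show G →ₗ[S] K from x) t)

theorem HomMod.categoryProjective (h : InAdd (S := S) G M) :
    Projective (ModuleCat.of (Module.End S G)ᵐᵒᵖ (HomMod (S := S) G M)) := by
  rw [← IsProjective.iff_projective]
  exact HomMod.projective G h

variable (G) in
/-- `Hom(G, -)` turns an exact sequence along which all maps from `G` lift into a short exact
sequence. -/
theorem HomMod.shortExact (f : K →ₗ[S] X) (g : X →ₗ[S] M) (hf : Function.Injective f)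
    (hfg : Function.Exact f g) (hg : Function.Surjective (HomMod.map G g)) :
    (ShortComplex.mk (ModuleCat.ofHom (HomMod.map G f)) (ModuleCat.ofHom (HomMod.map G g))
      (by
        rw [← ModuleCat.ofHom_comp, ← HomMod.map_comp, hfg.linearMap_comp_eq_zero]
        rfl)).ShortExact :=
  ModuleCat.shortComplex_shortExact _ (HomMod.map_exact G f g hf hfg)
    (HomMod.map_injective G f hf) hg

/-- `Hom(G, -)` turns the approximation into a projective resolution of length one. -/
theorem HomMod.hasProjectiveDimensionLE_one (g : X →ₗ[S] M) (hX : InAdd (S := S) G X)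
    (hK : InAdd (S := S) G (LinearMap.ker g)) (hg : ∀ h : G →ₗ[S] M, ∃ h' : G →ₗ[S] X, g ∘ₗ h' = h) :
    HasProjectiveDimensionLE (ModuleCat.of (Module.End S G)ᵐᵒᵖ (HomMod (S := S) G M)) 1 := by
  have h := HomMod.shortExact G (LinearMap.ker g).subtype g (Submodule.subtype_injective _)
    (LinearMap.exact_subtype_ker_map g) hg
  have h1 := HomMod.categoryProjective hX
  have h2 := HomMod.categoryProjective hK
  exact h.hasProjectiveDimensionLT_X₃ 1 inferInstance inferInstance

theorem HomMod.hasProjectiveDimensionLE_prod {Y Z : Type u} [AddCommGroup Y] [Module S Y]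
    [AddCommGroup Z] [Module S Z] (e : M ≃ₗ[S] Y × Z) (n : ℕ)
    (hY : HasProjectiveDimensionLE
      (ModuleCat.of (Module.End S G)ᵐᵒᵖ (HomMod (S := S) G Y)) n)
    (hZ : HasProjectiveDimensionLE
      (ModuleCat.of (Module.End S G)ᵐᵒᵖ (HomMod (S := S) G Z)) n) :
    HasProjectiveDimensionLE (ModuleCat.of (Module.End S G)ᵐᵒᵖ (HomMod (S := S) G M)) n := by
  refine (HomMod.shortExact G (e.symm.toLinearMap ∘ₗ LinearMap.inl S Y Z)
    (LinearMap.snd S Y Z ∘ₗ e.toLinearMap) (e.symm.injective.comp LinearMap.inl_injective)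
    ?_ ?_).hasProjectiveDimensionLT_X₂ _ hY hZ
  · intro m
    constructor
    · intro hm
      refine ⟨(e m).1, e.injective (Prod.ext ?_ ?_)⟩
      · simp
      · simpa using hm.symm
    · rintro ⟨y, rfl⟩
      simp
  · intro (h : G →ₗ[S] Z)
    refine ⟨(e.symm.toLinearMap ∘ₗ LinearMap.inr S Y Z ∘ₗ h : G →ₗ[S] M), ?_⟩
    refine LinearMap.ext fun x => ?_
    change (e (e.symm (0, h x))).2 = h x
    simp

/-- The global dimension of the endomorphism ring is at most `3` if the modules `Hom(G, M)` have
projective dimension at most `1`. -/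
theorem globalDimension_le_three [IsNoetherianRing S] [Module.Finite S G]
    [IsNoetherianRing (Module.End S G)ᵐᵒᵖ]
    (h : ∀ M : ModuleCat.{u} S, Module.Finite S M →
      HasProjectiveDimensionLE (ModuleCat.of (Module.End S G)ᵐᵒᵖ (HomMod (S := S) G M)) 1) :
    globalDimension (Module.End S G)ᵐᵒᵖ ≤ 3 := by
  refine iSup_le fun X => (projectiveDimension_le_iff X 3).2 ?_
  refine hasProjectiveDimensionLE_of_quotient 3 (fun I => ?_) X
  obtain ⟨k, f, hf⟩ := Module.Finite.exists_fin' (Module.End S G)ᵐᵒᵖ I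
  let e : Fin k → (G →ₗ[S] G) := fun j => (f (Pi.single j 1) : (Module.End S G)ᵐᵒᵖ).unop
  -- The components of `g` are generators of `I`, so `φ` is composition with `g` and its kernel is
  -- `Hom(G, ker g)`.
  let g : (Fin k → G) →ₗ[S] G := ∑ j, e j ∘ₗ LinearMap.proj j
  let φ : HomMod (S := S) G (Fin k → G) →ₗ[(Module.End S G)ᵐᵒᵖ] I :=
    f ∘ₗ (HomMod.piEquiv G k).toLinearMap
  have hφ : ∀ x : G →ₗ[S] (Fin k → G),
      (φ x : (Module.End S G)ᵐᵒᵖ) = MulOpposite.op (g ∘ₗ x : G →ₗ[S] G) := by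
    intro x
    have hc : HomMod.piEquiv G k x =
        ∑ j, HomMod.piEquiv G k x j • (Pi.single j 1 : Fin k → (Module.End S G)ᵐᵒᵖ) :=
      funext fun j => by simp [Finset.sum_apply, Pi.single_apply]
    have h1 : φ x = ∑ j, HomMod.piEquiv G k x j • f (Pi.single j 1) := by
      simp only [← map_smul, ← map_sum, ← hc]
      rfl
    rw [h1]
    apply MulOpposite.unop_injective
    refine LinearMap.ext fun t => ?_
    simp only [AddSubmonoidClass.coe_finsetSum, Finset.unop_sum, MulOpposite.unop_op, g,
      LinearMap.sum_apply, LinearMap.comp_apply]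
    rfl
  have hex : (ShortComplex.mk (ModuleCat.ofHom (HomMod.map G (LinearMap.ker g).subtype))
      (ModuleCat.ofHom φ) (by
        ext x
        exact (hφ _).trans (congrArg MulOpposite.op
          (LinearMap.ext fun t => ((show G →ₗ[S] LinearMap.ker g from x) t).2)))).ShortExact := by
    refine ModuleCat.shortComplex_shortExact _ ?_
      (HomMod.map_injective G _ (Submodule.subtype_injective _))
      (hf.comp (HomMod.piEquiv G k).surjective)
    intro (x : G →ₗ[S] (Fin k → G))
    refine Iff.trans ?_ (HomMod.map_exact G (LinearMap.ker g).subtype g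
      (Submodule.subtype_injective _) (LinearMap.exact_subtype_ker_map g) x)
    change φ x = 0 ↔ _
    rw [← Submodule.coe_eq_zero, hφ, MulOpposite.op_eq_zero_iff]
    rfl
  have hX₂ := HomMod.categoryProjective (G := G) (M := Fin k → G)
    (inAdd_pi (Fin k) (LinearEquiv.refl S _))
  -- The index is strict: `I` has projective dimension at most 2, hence the quotient by `I` at most
  -- 3.
  have hI : HasProjectiveDimensionLT (ModuleCat.of (Module.End S G)ᵐᵒᵖ I) 3 :=
    hex.hasProjectiveDimensionLT_X₃ 2 (h (ModuleCat.of S (LinearMap.ker g)) inferInstance)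
      (hasProjectiveDimensionLT_of_ge _ 1 3 (by simp))
  have hII : (ShortComplex.mk (ModuleCat.ofHom I.subtype) (ModuleCat.ofHom I.mkQ)
      (by ext x; simp)).ShortExact :=
    ModuleCat.shortComplex_shortExact _ (LinearMap.exact_subtype_mkQ I)
      I.injective_subtype I.mkQ_surjective
  have hE : Projective (ModuleCat.of (Module.End S G)ᵐᵒᵖ (Module.End S G)ᵐᵒᵖ) := by
    rw [← IsProjective.iff_projective]
    infer_instance
  exact hII.hasProjectiveDimensionLT_X₃ 3 hI (hasProjectiveDimensionLT_of_ge _ 1 4 (by simp))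

/-- A copresentation of a module outside `add G` by modules in `add G` shows that the global
dimension of the endomorphism ring is at least `3`. -/
theorem three_le_globalDimension (i : S →ₗ[S] G) (q : G →ₗ[S] S) (hq : q ∘ₗ i = LinearMap.id)
    (hM : ¬ InAdd (S := S) G M) {k : ℕ} (p : (Fin k → G) →ₗ[S] M)
    (hp : ∀ h : G →ₗ[S] M, ∃ h' : G →ₗ[S] (Fin k → G), p ∘ₗ h' = h)
    (f : M →ₗ[S] K) (g : K →ₗ[S] X) (hf : Function.Injective f) (hfg : Function.Exact f g)
    (hK : InAdd (S := S) G K) (hX : InAdd (S := S) G X) :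
    3 ≤ globalDimension (Module.End S G)ᵐᵒᵖ := by
  let φ := HomMod.map G g
  refine le_trans ?_ (le_iSup _ (ModuleCat.of _ (HomMod (S := S) G X ⧸ LinearMap.range φ)))
  rw [show (3 : WithBot ℕ∞) = ((3 : ℕ) : WithBot ℕ∞) from rfl, projectiveDimension_ge_iff]
  -- If the cokernel had dimension at most 2, two syzygies down `Hom(G, M)` would be projective.
  intro hC
  have h1 : (ShortComplex.mk (ModuleCat.ofHom (LinearMap.range φ).subtype)
      (ModuleCat.ofHom (LinearMap.range φ).mkQ) (by ext x; simp)).ShortExact :=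
    ModuleCat.shortComplex_shortExact _ (LinearMap.exact_subtype_mkQ _)
      (Submodule.subtype_injective _) (Submodule.mkQ_surjective _)
  have h2 : (ShortComplex.mk (ModuleCat.ofHom (HomMod.map G f))
      (ModuleCat.ofHom φ.rangeRestrict) (by
        ext x
        exact (HomMod.map_exact G f g hf hfg).apply_apply_eq_zero x)).ShortExact := by
    refine ModuleCat.shortComplex_shortExact _ ?_ (HomMod.map_injective G f hf)
      φ.surjective_rangeRestrict
    intro x
    refine Iff.trans ?_ (HomMod.map_exact G f g hf hfg x)
    exact Subtype.ext_iff
  have pX := HomMod.categoryProjective hX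
  have pK := HomMod.categoryProjective hK
  have h3 := h1.hasProjectiveDimensionLT_X₁ 2 (hasProjectiveDimensionLT_of_ge _ 1 2 (by simp)) hC
  have h4 := h2.hasProjectiveDimensionLT_X₁ 1 inferInstance h3
  have h5 : Projective (ModuleCat.of (Module.End S G)ᵐᵒᵖ (HomMod (S := S) G M)) :=
    projective_iff_hasProjectiveDimensionLT_one.2 h4
  rw [← IsProjective.iff_projective] at h5
  exact hM (inAdd_of_homMod_projective G i q hq h5 p hp)

end GlobalDimension

/-! ### Approximations with kernel in `add G` -/

section Approximation

variable {S : Type u} [Ring S]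

/-- `M` has a right `add G`-approximation with kernel in `add G`. -/
def HasShortApproximation (G M : Type u) [AddCommGroup G] [Module S G] [AddCommGroup M]
    [Module S M] : Prop :=
  ∃ (X : ModuleCat.{u} S) (g : X →ₗ[S] M), InAdd (S := S) G X ∧
    InAdd (S := S) G (LinearMap.ker g) ∧ ∀ h : G →ₗ[S] M, ∃ h' : G →ₗ[S] X, g ∘ₗ h' = h

variable {P Q M X : Type u} [AddCommGroup P] [Module S P] [AddCommGroup Q] [Module S Q]
  [AddCommGroup M] [Module S M] [AddCommGroup X] [Module S X]

theorem hasShortApproximation_of_inAdd {G : Type u} [AddCommGroup G] [Module S G]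
    (h : InAdd (S := S) G M) : HasShortApproximation (S := S) G M := by
  refine ⟨ModuleCat.of S M, LinearMap.id, h, ?_, fun h => ⟨h, rfl⟩⟩
  rw [LinearMap.ker_id]
  exact inAdd_of_subsingleton

theorem exists_lift_prod [Module.Projective S P] (g : X →ₗ[S] M) (hg : Function.Surjective g)
    (hQ : ∀ h : Q →ₗ[S] M, ∃ h' : Q →ₗ[S] X, g ∘ₗ h' = h) (h : P × Q →ₗ[S] M) :
    ∃ h' : P × Q →ₗ[S] X, g ∘ₗ h' = h := by
  obtain ⟨a, ha⟩ := Module.projective_lifting_property g (h ∘ₗ LinearMap.inl S P Q) hg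
  obtain ⟨b, hb⟩ := hQ (h ∘ₗ LinearMap.inr S P Q)
  refine ⟨a.coprod b, ?_⟩
  rw [LinearMap.comp_coprod, ha, hb, ← LinearMap.comp_coprod, LinearMap.coprod_inl_inr,
    LinearMap.comp_id]

theorem ker_projective_of_hasProjectiveDimensionLE_one (M : ModuleCat.{u} S)
    (hM : HasProjectiveDimensionLE M 1) [Module.Projective S X] (g : X →ₗ[S] M)
    (hg : Function.Surjective g) : Module.Projective S (LinearMap.ker g) := by
  rw [IsProjective.iff_projective]
  have hX : Projective (ModuleCat.of S X) := by rwa [← IsProjective.iff_projective]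
  exact projective_iff_hasProjectiveDimensionLT_one.2
    ((LinearMap.shortExact_shortComplexKer hg).hasProjectiveDimensionLT_X₁ 1
      (inferInstanceAs (HasProjectiveDimensionLT (ModuleCat.of S X) 1)) hM)

theorem quotient_injective_of_hasInjectiveDimensionLE_one (N : ModuleCat.{u} S)
    (hN : HasInjectiveDimensionLE N 1) (hX : Module.Injective S X) (j : N →ₗ[S] X)
    (hj : Function.Injective j) : Module.Injective S (X ⧸ LinearMap.range j) := by
  have hX' : Injective (ModuleCat.of S X) := (Module.injective_iff_injective_object S X).1 hX
  have h : (ShortComplex.mk (ModuleCat.ofHom j) (ModuleCat.ofHom (LinearMap.range j).mkQ)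
      (by ext x; simp)).ShortExact :=
    ModuleCat.shortComplex_shortExact _ (LinearMap.exact_map_mkQ_range j) hj
      (Submodule.mkQ_surjective _)
  rw [Module.injective_iff_injective_object]
  exact injective_iff_hasInjectiveDimensionLT_one.2
    (h.hasInjectiveDimensionLT_X₃ 1 inferInstance hN)

/-- A monomorphism `j` out of a summand of `ker g` splits, if the inclusion into `X` extends along
`j` and maps from the cokernel of `j` lift along `g`. -/
theorem exists_retraction_of_extension {N J : Type u} [AddCommGroup N] [Module S N]
    [AddCommGroup J] [Module S J] (g : X →ₗ[S] M) (s : N →ₗ[S] LinearMap.ker g)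
    (r : LinearMap.ker g →ₗ[S] N) (hrs : r ∘ₗ s = LinearMap.id) (j : N →ₗ[S] J)
    (h : J →ₗ[S] X) (hh : ∀ x, h (j x) = s x)
    (hJ : ∀ t : (J ⧸ LinearMap.range j) →ₗ[S] M, ∃ t' : (J ⧸ LinearMap.range j) →ₗ[S] X,
      g ∘ₗ t' = t) : ∃ ρ : J →ₗ[S] N, ρ ∘ₗ j = LinearMap.id := by
  obtain ⟨t, ht⟩ := hJ ((LinearMap.range j).liftQ (g ∘ₗ h) (by
    rintro _ ⟨x, rfl⟩
    rw [LinearMap.mem_ker, LinearMap.comp_apply, hh]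
    exact (s x).2))
  -- Subtracting the lift moves `h` into `ker g` without changing it on `N`.
  let δ : J →ₗ[S] X := h - t ∘ₗ (LinearMap.range j).mkQ
  have hδ : ∀ x, δ x ∈ LinearMap.ker g := by
    intro x
    have := congr($ht ((LinearMap.range j).mkQ x))
    simp only [LinearMap.comp_apply, Submodule.mkQ_apply, Submodule.liftQ_apply] at this
    simp [δ, this]
  refine ⟨r ∘ₗ δ.codRestrict _ hδ, LinearMap.ext fun x => ?_⟩
  have h1 : δ.codRestrict _ hδ (j x) = s x := by
    refine Subtype.ext ?_
    have h0 : (Submodule.Quotient.mk (j x) : J ⧸ LinearMap.range j) = 0 :=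
      (Submodule.Quotient.mk_eq_zero _).2 ⟨x, rfl⟩
    simp [δ, hh, h0]
  rw [LinearMap.comp_apply, LinearMap.comp_apply, h1]
  exact congr($hrs x)

/-- A summand of injective dimension at most `1` of the kernel of an `add Q`-approximation `g` is in
`add Q`, if its inclusion into the source of `g` extends to injective modules. -/
theorem inAdd_of_hasInjectiveDimensionLE_one (hQ : Module.Injective S Q) [Module.Finite S Q]
    (hcogen : ∀ M : ModuleCat.{u} S, Module.Finite S M → InCogen (S := S) Q M)
    (g : X →ₗ[S] M) (hg : ∀ h : Q →ₗ[S] M, ∃ h' : Q →ₗ[S] X, g ∘ₗ h' = h)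
    (N : ModuleCat.{u} S) (hNf : Module.Finite S N) (hN : HasInjectiveDimensionLE N 1)
    (s : N →ₗ[S] LinearMap.ker g) (r : LinearMap.ker g →ₗ[S] N) (hrs : r ∘ₗ s = LinearMap.id)
    (hext : ∀ (k : ℕ) (j : N →ₗ[S] (Fin k → Q)), Function.Injective j →
      ∃ h : (Fin k → Q) →ₗ[S] X, ∀ x, h (j x) = s x) : InAdd (S := S) Q N := by
  obtain ⟨k, j, hj⟩ := hcogen N hNf
  obtain ⟨h, hh⟩ := hext k j hj
  have hQk : Module.Injective S (Fin k → Q) :=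
    (inAdd_pi (Fin k) (LinearEquiv.refl S (Fin k → Q))).injective hQ
  -- The cokernel of `j` is injective because `id N ≤ 1`, so it lies in `add Q` and maps from it
  -- lift along `g`.
  have hC := inAdd_of_injective
    (quotient_injective_of_hasInjectiveDimensionLE_one N hN hQk j hj)
    (hcogen (ModuleCat.of S ((Fin k → Q) ⧸ LinearMap.range j)) inferInstance)
  obtain ⟨ρ, hρ⟩ := exists_retraction_of_extension g s r hrs j h hh
    fun t => hC.exists_lift g hg t
  exact ⟨k, j, ρ, hρ⟩

variable [IsArtinianRing S] [IsNoetherianRing S]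

/-- Sufficient conditions for short approximations, by the class `Gen Q`. -/
theorem hasShortApproximation_of_gen (e : P ≃ₗ[S] S) (hQ : Module.Injective S Q)
    [Module.Finite S Q]
    (hcogen : ∀ M : ModuleCat.{u} S, Module.Finite S M → InCogen (S := S) Q M)
    (happ : ∀ M : ModuleCat.{u} S, Module.Finite S M → ∃ (k : ℕ) (f : (Fin k → Q) →ₗ[S] M),
      ∀ g : Q →ₗ[S] M, ∃ h : Q →ₗ[S] (Fin k → Q), f ∘ₗ h = g)
    (h1 : ∀ M : ModuleCat.{u} S, IsInd M → Subsingleton (Q →ₗ[S] M) →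
      HasProjectiveDimensionLE M 1)
    (h2 : ∀ M : ModuleCat.{u} S, IsInd M → Nontrivial (Q →ₗ[S] M) →
      ¬ InAdd (S := S) P M → InGen (S := S) Q M)
    (h3 : ∀ M : ModuleCat.{u} S, IsInd M → ¬ HasInjectiveDimensionLE M 1 → InAdd (S := S) P M)
    (M : ModuleCat.{u} S) (hM : IsInd M) : HasShortApproximation (S := S) (P × Q) M := by
  have hP : Module.Projective S P := Module.Projective.of_equiv e.symm
  have hMf := hM.1
  by_cases hPM : InAdd (S := S) P M
  · exact hasShortApproximation_of_inAdd hPM.prod_left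
  rcases subsingleton_or_nontrivial (Q →ₗ[S] M) with hQM | hQM
  · obtain ⟨n, g, hg⟩ := Module.Finite.exists_fin' S M
    have hker := ker_projective_of_hasProjectiveDimensionLE_one M (h1 M hM hQM) g hg
    refine ⟨ModuleCat.of S (Fin n → S), g,
      ((inAdd_of_projective (N := Fin n → S)).of_equiv e.symm).prod_left,
      (inAdd_of_projective.of_equiv e.symm).prod_left,
      exists_lift_prod g hg fun h => ⟨0, Subsingleton.elim _ _⟩⟩
  · obtain ⟨n, p, hp⟩ := h2 M hM hQM hPM
    obtain ⟨k, g, hg⟩ := happ M hM.1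
    have hQk : InAdd (S := S) Q (Fin k → Q) := inAdd_pi (Fin k) (LinearEquiv.refl S _)
    obtain ⟨p', hp'⟩ :=
      (inAdd_pi (Fin n) (LinearEquiv.refl S (Fin n → Q))).exists_lift g hg p
    -- A surjection from a power of `Q` factors through the approximation.
    have hgs : Function.Surjective g := by
      rw [← hp'] at hp
      exact Function.Surjective.of_comp hp
    refine ⟨ModuleCat.of S (Fin k → Q), g, hQk.prod_right, ?_, exists_lift_prod g hgs hg⟩
    refine inAdd_of_indecomposable_retracts fun N hN s r hrs => ?_
    by_cases hNi : HasInjectiveDimensionLE N 1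
    · refine (inAdd_of_hasInjectiveDimensionLE_one hQ hcogen g hg N hN.1 hNi s r hrs
        fun l j hj => ?_).prod_right
      exact (hQk.injective hQ).out j hj ((LinearMap.ker g).subtype ∘ₗ s)
    · exact (h3 N hN hNi).prod_left

/-- Sufficient conditions for short approximations, by the class `Cogen P`. -/
theorem hasShortApproximation_of_cogen (e : P ≃ₗ[S] S) (hQ : Module.Injective S Q)
    [Module.Finite S Q]
    (hcogen : ∀ M : ModuleCat.{u} S, Module.Finite S M → InCogen (S := S) Q M)
    (happ : ∀ M : ModuleCat.{u} S, Module.Finite S M → ∃ (k : ℕ) (f : (Fin k → Q) →ₗ[S] M),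
      ∀ g : Q →ₗ[S] M, ∃ h : Q →ₗ[S] (Fin k → Q), f ∘ₗ h = g)
    (h1 : ∀ M : ModuleCat.{u} S, IsInd M → Subsingleton (M →ₗ[S] P) →
      HasInjectiveDimensionLE M 1)
    (h2 : ∀ M : ModuleCat.{u} S, IsInd M → ¬ HasProjectiveDimensionLE M 1 →
      InAdd (S := S) Q M)
    (h3 : ∀ M : ModuleCat.{u} S, IsInd M → Nontrivial (M →ₗ[S] P) →
      ¬ InAdd (S := S) Q M → InCogen (S := S) P M)
    (M : ModuleCat.{u} S) (hM : IsInd M) : HasShortApproximation (S := S) (P × Q) M := by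
  have hP : Module.Projective S P := Module.Projective.of_equiv e.symm
  have hPf : Module.Finite S P := Module.Finite.equiv e.symm
  have hMf := hM.1
  by_cases hQM : InAdd (S := S) Q M
  · exact hasShortApproximation_of_inAdd hQM.prod_right
  obtain ⟨n, p, hp⟩ := Module.Finite.exists_fin' S M
  have hker := ker_projective_of_hasProjectiveDimensionLE_one M
    (by_contra fun h => hQM (h2 M hM h)) p hp
  obtain ⟨k, f, hf⟩ := happ M hM.1
  have hQk : InAdd (S := S) Q (Fin k → Q) := inAdd_pi (Fin k) (LinearEquiv.refl S _)
  let g : (Fin n → S) × (Fin k → Q) →ₗ[S] M := p.coprod f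
  have hg : Function.Surjective g := fun m => by
    obtain ⟨x, rfl⟩ := hp m
    exact ⟨(x, 0), by simp [g]⟩
  have hgQ : ∀ h : Q →ₗ[S] M, ∃ h' : Q →ₗ[S] (Fin n → S) × (Fin k → Q), g ∘ₗ h' = h := by
    intro h
    obtain ⟨h', hh'⟩ := hf h
    refine ⟨LinearMap.inr S _ _ ∘ₗ h', ?_⟩
    rw [← LinearMap.comp_assoc, LinearMap.coprod_inr, hh']
  refine ⟨ModuleCat.of S ((Fin n → S) × (Fin k → Q)), g,
    ((inAdd_of_projective (N := Fin n → S)).of_equiv e.symm).prod_left.prod hQk.prod_right, ?_,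
    exists_lift_prod g hg hgQ⟩
  refine inAdd_of_indecomposable_retracts fun N hN s r hrs => ?_
  have hrs' : ∀ x, r (s x) = x := fun x => congr($hrs x)
  have hNf := hN.1
  let sQ : N →ₗ[S] (Fin k → Q) := LinearMap.snd S _ _ ∘ₗ (LinearMap.ker g).subtype ∘ₗ s
  rcases subsingleton_or_nontrivial (N →ₗ[S] P) with hNP | hNP
  · refine (inAdd_of_hasInjectiveDimensionLE_one hQ hcogen g hgQ N hN.1 (h1 N hN hNP) s r hrs
      fun l j hj => ?_).prod_right
    obtain ⟨h, hh⟩ := (hQk.injective hQ).out j hj sQ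
    refine ⟨LinearMap.inr S _ _ ∘ₗ h, fun x => Prod.ext (funext fun i => ?_) (hh x)⟩
    -- As `Hom(N, P) = 0`, the inclusion of `N` has no free component, so extending `sQ` suffices.
    have h0 : e.symm.toLinearMap ∘ₗ LinearMap.proj i ∘ₗ LinearMap.fst S _ _ ∘ₗ
      (LinearMap.ker g).subtype ∘ₗ s = 0 := Subsingleton.elim _ _
    have h0x := congr($h0 x)
    simp only [LinearMap.comp_apply, LinearMap.zero_apply, LinearEquiv.coe_coe,
      LinearEquiv.map_eq_zero_iff] at h0x
    exact h0x.symm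
  by_cases hNQ : InAdd (S := S) Q N
  · exact hNQ.prod_right
  obtain ⟨m, v, hv⟩ := h3 N hN hNP hNQ
  -- the component of `s` in `Q ^ k` factors through the projective module `P ^ m`
  obtain ⟨w, hw⟩ := (hQk.injective hQ).out v hv sQ
  let π : LinearMap.ker g →ₗ[S] (Fin k → Q) := LinearMap.snd S _ _ ∘ₗ (LinearMap.ker g).subtype
  -- Surjectivity of `p` makes `0 → ker p → ker g → Qᵏ → 0` exact.
  have hπ : Function.Surjective π := fun y => by
    obtain ⟨x, hx⟩ := hp (-f y)
    exact ⟨⟨(x, y), by simp [g, hx]⟩, rfl⟩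
  have hPm : Module.Projective S (Fin m → P) :=
    Module.Projective.of_equiv (LinearEquiv.piCongrRight fun _ : Fin m => e.symm)
  obtain ⟨w', hw'⟩ := Module.projective_lifting_property π w hπ
  -- The difference has no component in `Qᵏ`, so it lands in `ker p`; hence `s` factors through the
  -- projective module `Pᵐ × ker p`.
  let d : N →ₗ[S] LinearMap.ker g := s - w' ∘ₗ v
  have hd2 : ∀ x, (d x : (Fin n → S) × (Fin k → Q)).2 = 0 := by
    intro x
    have h1 : (w' (v x) : (Fin n → S) × (Fin k → Q)).2 = w (v x) := congr($hw' (v x))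
    have h2 : w (v x) = (s x : (Fin n → S) × (Fin k → Q)).2 := hw x
    simp [d, h1, h2]
  have hd1 : ∀ x, (d x : (Fin n → S) × (Fin k → Q)).1 ∈ LinearMap.ker p := by
    intro x
    have h1 : p (d x : (Fin n → S) × (Fin k → Q)).1 + f (d x : (Fin n → S) × (Fin k → Q)).2 = 0 :=
      (d x).2
    rwa [hd2, map_zero, add_zero] at h1
  let t : N →ₗ[S] LinearMap.ker p :=
    (LinearMap.fst S _ _ ∘ₗ (LinearMap.ker g).subtype ∘ₗ d).codRestrict _ hd1
  let incl : LinearMap.ker p →ₗ[S] LinearMap.ker g :=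
    (LinearMap.inl S (Fin n → S) (Fin k → Q) ∘ₗ (LinearMap.ker p).subtype).codRestrict _
      (fun x => by simp [g])
  have hinc : ∀ x, incl (t x) = d x := fun x =>
    Subtype.ext (Prod.ext rfl (hd2 x).symm)
  have hNproj : Module.Projective S N := by
    refine Module.Projective.of_split (v.prod t) (r ∘ₗ w'.coprod incl) ?_
    refine LinearMap.ext fun x => ?_
    change r (w' (v x) + incl (t x)) = x
    rw [hinc]
    simp [d, hrs']
  exact (inAdd_of_projective.of_equiv e.symm).prod_left

end Approximation

/-! ### The injective envelope of `R ⧸ rad R` -/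

section Envelope

variable {R : Type u} [CommRing R]

theorem smul_quotient_eq_zero {I : Ideal R} {r : R} (hr : r ∈ I) (m : R ⧸ I) : r • m = 0 := by
  obtain ⟨m, rfl⟩ := Submodule.Quotient.mk_surjective _ m
  rw [← Submodule.Quotient.mk_smul, Submodule.Quotient.mk_eq_zero]
  exact Ideal.mul_mem_right _ _ hr

/-- If `R ⧸ I` is semisimple, then the elements of an injective envelope of an `R ⧸ I`-module that are
annihilated by `I` lie in that module. -/
theorem IsInjectiveEnvelope.torsionBySet_le_range {M E : Type u} [AddCommGroup M] [Module R M]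
    [AddCommGroup E] [Module R E] {ι : M →ₗ[R] E} (hι : IsInjectiveEnvelope ι) (I : Ideal R)
    [IsSemisimpleRing (R ⧸ I)] (hM : ∀ r ∈ I, ∀ m : M, r • m = 0) :
    Submodule.torsionBySet R E (I : Set R) ≤ LinearMap.range ι := by
  let T := Submodule.torsionBySet R E (I : Set R)
  have hT : Module.IsTorsionBySet R T (I : Set R) :=
    Submodule.torsionBySet_isTorsionBySet (R := R) (M := E) (I : Set R)
  have hss : IsSemisimpleModule R T := by
    let := hT.module
    exact hT.isSemisimpleModule_iff.1 inferInstance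
  have hle : LinearMap.range ι ≤ T := by
    rintro _ ⟨m, rfl⟩
    exact (Submodule.mem_torsionBySet_iff _ _).2 fun a => by rw [← map_smul, hM a a.2, map_zero]
  -- `T` is semisimple, and by essentiality a complement of the image of `ι` in it vanishes.
  obtain ⟨C, hC⟩ := exists_isCompl ((LinearMap.range ι).comap T.subtype)
  have hC0 : C.map T.subtype = ⊥ := by
    apply hι.essential
    rw [Submodule.eq_bot_iff]
    rintro _ ⟨⟨c, hc, rfl⟩, hx⟩
    have := (Submodule.eq_bot_iff _).1 hC.inf_eq_bot c ⟨hx, hc⟩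
    rw [this, map_zero]
  have hC1 : C = ⊥ := 
    Submodule.map_injective_of_injective T.subtype_injective (hC0.trans (Submodule.map_bot _).symm)
  have hC2 := hC.sup_eq_top
  rw [hC1, sup_bot_eq, Submodule.comap_subtype_eq_top] at hC2
  exact hC2

/-- If the submodule annihilated by a finitely generated ideal is noetherian, then so is the one
annihilated by any power. -/
theorem isNoetherian_torsionBySet_pow {E : Type u} [AddCommGroup E] [Module R E] (I : Ideal R)
    (hI : I.FG) (h : IsNoetherian R (Submodule.torsionBySet R E (I : Set R))) (n : ℕ) :
    IsNoetherian R (Submodule.torsionBySet R E ((I ^ n : Ideal R) : Set R)) := by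
  induction n with
  | zero =>
    have h0 : Submodule.torsionBySet R E ((I ^ 0 : Ideal R) : Set R) = ⊥ := by
      rw [Submodule.eq_bot_iff]
      intro x hx
      have := (Submodule.mem_torsionBySet_iff _ _).1 hx ⟨1, by simp⟩
      simpa using this
    rw [h0]
    infer_instance
  | succ n ih =>
    obtain ⟨s, rfl⟩ := hI
    set I := Ideal.span (s : Set R)
    let T := Submodule.torsionBySet R E ((I ^ (n + 1) : Ideal R) : Set R)
    let T' := Submodule.torsionBySet R E ((I ^ n : Ideal R) : Set R)
    -- Multiplication by the generators of `I` lowers the torsion exponent by one; its kernel is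
    -- killed by `I`.
    let ψ : T →ₗ[R] (s → T') := LinearMap.pi fun r =>
      ((LinearMap.lsmul R E r) ∘ₗ T.subtype).codRestrict T' fun x => by
        refine (Submodule.mem_torsionBySet_iff _ _).2 fun a => ?_
        have hr : (r : R) ∈ I := Ideal.subset_span r.2
        have := (Submodule.mem_torsionBySet_iff _ _).1 x.2
          ⟨a * r, by rw [pow_succ]; exact Ideal.mul_mem_mul a.2 hr⟩
        simpa [mul_smul] using this
    have hk : ∀ x ∈ LinearMap.ker ψ, (x : E) ∈ Submodule.torsionBySet R E (I : Set R) := by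
      intro x hx
      have h1 : ∀ r ∈ s, r • (x : E) = 0 := fun r hr =>
        congr(($(LinearMap.mem_ker.1 hx) ⟨r, hr⟩ : E))
      have h2 : I ≤ Ideal.torsionOf R E x := Ideal.span_le.2 fun r hr => h1 r hr
      exact (Submodule.mem_torsionBySet_iff _ _).2 fun a => h2 a.2
    have hker : IsNoetherian R (LinearMap.ker ψ) :=
      isNoetherian_of_injective ((T.subtype ∘ₗ (LinearMap.ker ψ).subtype).codRestrict
        (Submodule.torsionBySet R E (I : Set R)) fun x => hk x x.2)
        fun x y hxy => Subtype.ext (Subtype.ext congr(($hxy : E)))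
    exact isNoetherian_of_range_eq_ker (LinearMap.ker ψ).subtype ψ (Submodule.range_subtype _)

/-- An injective envelope of `R ⧸ rad R` is noetherian if `R` is artinian. -/
theorem isNoetherian_injectiveEnvelope [IsArtinianRing R] :
    IsNoetherian R (injectiveEnvelope R (R ⧸ Ring.jacobson R)) := by
  obtain ⟨ι, hι⟩ := injectiveEnvelope_spec (S := R) (R ⧸ Ring.jacobson R)
  have h1 := hι.torsionBySet_le_range (Ring.jacobson R) fun r hr m =>
    smul_quotient_eq_zero hr m
  have h2 : IsNoetherian R (LinearMap.range ι) := inferInstance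
  have h3 := isNoetherian_torsionBySet_pow (E := injectiveEnvelope R (R ⧸ Ring.jacobson R))
    (Ring.jacobson R) (IsNoetherian.noetherian _) (isNoetherian_of_le h1)
  obtain ⟨n, hn⟩ := IsSemiprimaryRing.isNilpotent (R := R)
  have h4 := h3 n
  have h5 : Submodule.torsionBySet R (injectiveEnvelope R (R ⧸ Ring.jacobson R))
      ((Ring.jacobson R ^ n : Ideal R) : Set R) = ⊤ := by
    rw [eq_top_iff]
    intro x _
    refine (Submodule.mem_torsionBySet_iff _ _).2 fun a => ?_
    have ha : (a : R) ∈ (0 : Ideal R) := hn ▸ a.2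
    replace ha : (a : R) = 0 := ha
    rw [ha, zero_smul]
  rwa [h5, isNoetherian_top_iff] at h4

/-- The injective envelope of `R ⧸ rad R` is a cogenerator. -/
theorem exists_apply_ne_zero_injectiveEnvelope [IsArtinianRing R] {M : Type u} [AddCommGroup M]
    [Module R M] (m : M) (hm : m ≠ 0) :
    ∃ φ : M →ₗ[R] injectiveEnvelope R (R ⧸ Ring.jacobson R), φ m ≠ 0 := by
  obtain ⟨ι, hι⟩ := injectiveEnvelope_spec (S := R) (R ⧸ Ring.jacobson R)
  have hne : Ideal.torsionOf R M m ≠ ⊤ := fun h => hm (by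
    have : (1 : R) ∈ Ideal.torsionOf R M m := h ▸ Submodule.mem_top
    simpa using this)
  obtain ⟨𝔪, h𝔪, hle⟩ := Ideal.exists_le_maximal _ hne
  have hJ : Ring.jacobson R ≤ 𝔪 := by
    rw [Ring.jacobson_eq_sInf_isMaximal]
    exact sInf_le h𝔪
  have hss : IsSemisimpleModule R (R ⧸ Ring.jacobson R) := by
    have hT : Module.IsTorsionBySet R (R ⧸ Ring.jacobson R) (Ring.jacobson R : Set R) :=
      fun m r => smul_quotient_eq_zero r.2 m
    let := hT.module
    exact hT.isSemisimpleModule_iff.1 inferInstance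
  -- By semisimplicity the quotient `R ⧸ 𝔪` of `R ⧸ rad R` is also a submodule of it. This gives a
  -- map from `R ∙ m` to the envelope that is nonzero at `m`.
  obtain ⟨T, ⟨e⟩⟩ := IsSemisimpleModule.exists_submodule_linearEquiv_quotient
    (LinearMap.ker (Submodule.factor hJ))
  let e' : (R ⧸ 𝔪) ≃ₗ[R] T := (e ≪≫ₗ LinearMap.quotKerEquivOfSurjective _
    (Submodule.factor_surjective hJ)).symm
  let g : (R ∙ m) →ₗ[R] injectiveEnvelope R (R ⧸ Ring.jacobson R) :=
    ι ∘ₗ T.subtype ∘ₗ e'.toLinearMap ∘ₗ Submodule.factor hle ∘ₗ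
      (Ideal.quotTorsionOfEquivSpanSingleton R M m).symm.toLinearMap
  obtain ⟨φ, hφ⟩ := hι.injective_module.out (R ∙ m).subtype (Submodule.subtype_injective _) g
  refine ⟨φ, ?_⟩
  have h1 := hφ ⟨m, Submodule.mem_span_singleton_self m⟩
  change φ m = _ at h1
  rw [h1]
  have h2 : (Ideal.quotTorsionOfEquivSpanSingleton R M m).symm
      ⟨m, Submodule.mem_span_singleton_self m⟩ = Submodule.Quotient.mk 1 := by
    rw [LinearEquiv.symm_apply_eq, Ideal.quotTorsionOfEquivSpanSingleton_apply_mk]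
    simp
  have h3 : (Submodule.Quotient.mk 1 : R ⧸ 𝔪) ≠ 0 := fun h =>
    h𝔪.ne_top ((Ideal.eq_top_iff_one 𝔪).2 ((Submodule.Quotient.mk_eq_zero _).1 h))
  intro h0
  apply h3
  apply e'.injective
  apply T.subtype_injective
  apply hι.injective_map
  rw [map_zero, map_zero, map_zero, ← h0]
  simp only [g, LinearMap.comp_apply, LinearEquiv.coe_coe, h2]
  rfl

end Envelope
-- Cogenerators, existence of approximations, noetherian endomorphism rings
section Cogenerator

variable {S : Type u} [Ring S] {Q M : Type u} [AddCommGroup Q] [Module S Q] [AddCommGroup M]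
  [Module S M]

/-- An artinian module whose elements are separated by maps to `Q` embeds into some `Qⁿ`. -/
theorem inCogen_of_separated [IsArtinian S M] (h : ∀ m : M, m ≠ 0 → ∃ ψ : M →ₗ[S] Q, ψ m ≠ 0) :
    InCogen (S := S) Q M := by
  obtain ⟨_, ⟨n, f, rfl⟩, hmin⟩ := IsArtinian.set_has_minimal
    {K : Submodule S M | ∃ (n : ℕ) (f : M →ₗ[S] (Fin n → Q)), LinearMap.ker f = K}
    ⟨_, 0, 0, rfl⟩
  refine ⟨n, f, (injective_iff_map_eq_zero f).2 fun m hm => by_contra fun hne => ?_⟩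
  obtain ⟨ψ, hψ⟩ := h m hne
  let f' : M →ₗ[S] (Fin (n + 1) → Q) :=
    LinearMap.pi (Fin.cons ψ fun i => LinearMap.proj i ∘ₗ f)
  have hf' : ∀ x, f' x = 0 → ψ x = 0 ∧ f x = 0 := fun x hx =>
    ⟨congrFun hx 0, funext fun i => congrFun hx i.succ⟩
  -- Adjoining `ψ` would make the minimal kernel strictly smaller.
  refine hmin _ ⟨n + 1, f', rfl⟩ (lt_of_le_of_ne (fun x hx => (hf' x hx).2) fun heq => ?_)
  exact hψ (hf' m (heq.ge hm)).1

variable {R : Type u} [CommRing R] [IsNoetherianRing R] [Algebra R S] [Module R Q]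
  [IsScalarTower R S Q] [Module R M] [IsScalarTower R S M]

/-- Finite modules over a module-finite algebra have right `add Q`-approximations. -/
theorem exists_approximation [Module.Finite R Q] [Module.Finite R M] :
    ∃ (k : ℕ) (f : (Fin k → Q) →ₗ[S] M),
      ∀ g : Q →ₗ[S] M, ∃ h : Q →ₗ[S] (Fin k → Q), f ∘ₗ h = g := by
  have : IsNoetherian R (Q →ₗ[S] M) :=
    isNoetherian_of_injective (LinearMap.restrictScalarsₗ R S Q M R)
      (LinearMap.restrictScalars_injective R)
  obtain ⟨k, φ, hφ⟩ := Module.Finite.exists_fin' R (Q →ₗ[S] M)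
  -- The map collects `R`-generators of `Hom(Q, M)`; a combination of them lifts by scalar
  -- endomorphisms of `Q`.
  refine ⟨k, ∑ j, φ (Pi.single j 1) ∘ₗ LinearMap.proj j, fun g => ?_⟩
  obtain ⟨c, rfl⟩ := hφ g
  refine ⟨LinearMap.pi fun j => c j • LinearMap.id, LinearMap.ext fun x => ?_⟩
  have hc : c = ∑ j, c j • (Pi.single j 1 : Fin k → R) :=
    funext fun j => by simp [Finset.sum_apply, Pi.single_apply]
  conv_rhs => rw [hc]
  simp [LinearMap.sum_apply]

theorem isNoetherianRing_end_op {G : Type u} [AddCommGroup G] [Module S G] [Module R G]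
    [IsScalarTower R S G] [Module.Finite R G] : IsNoetherianRing (Module.End S G)ᵐᵒᵖ := by
  have h1 : IsNoetherian R (G →ₗ[S] G) :=
    isNoetherian_of_injective (LinearMap.restrictScalarsₗ R S G G R)
      (LinearMap.restrictScalars_injective R)
  have h2 : IsNoetherian R (Module.End S G)ᵐᵒᵖ :=
    isNoetherian_of_linearEquiv (M := Module.End S G) (MulOpposite.opLinearEquiv R)
  exact isNoetherian_of_tower R h2

end Cogenerator

/-! ### The module `DA` and the conclusion -/

section Dual

variable (R A : Type u) [CommRing R] [Ring A] [Algebra R A]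

noncomputable instance : Module R (DA R A) :=
  inferInstanceAs (Module R (A →ₗ[R] injectiveEnvelope R (R ⧸ Ring.jacobson R)))

theorem DA.op_smul_apply (a : Aᵐᵒᵖ) (f : DA R A) (x : A) :
    (show A →ₗ[R] injectiveEnvelope R (R ⧸ Ring.jacobson R) from a • f) x =
      (show A →ₗ[R] injectiveEnvelope R (R ⧸ Ring.jacobson R) from f) (a.unop * x) := rfl

instance : IsScalarTower R Aᵐᵒᵖ (DA R A) where
  smul_assoc r a f := by
    refine LinearMap.ext fun x => ?_
    rw [DA.op_smul_apply, MulOpposite.unop_smul, smul_mul_assoc, map_smul]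
    rfl

variable {R A}

/-- The map to `D A` corresponding to an `R`-linear map to the injective envelope. -/
noncomputable def DA.lift {M : Type u} [AddCommGroup M] [Module R M] [Module Aᵐᵒᵖ M]
    [IsScalarTower R Aᵐᵒᵖ M]
    (φ : M →ₗ[R] injectiveEnvelope R (R ⧸ Ring.jacobson R)) : M →ₗ[Aᵐᵒᵖ] DA R A where
  toFun m := φ ∘ₗ (LinearMap.toSpanSingleton Aᵐᵒᵖ M m).restrictScalars R ∘ₗ
    (MulOpposite.opLinearEquiv R).toLinearMap
  map_add' m m' := LinearMap.ext fun x =>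
    (congrArg φ (smul_add (MulOpposite.op x) m m')).trans (map_add φ _ _)
  map_smul' a m := LinearMap.ext fun x => by
    change φ (MulOpposite.op x • a • m) = φ (MulOpposite.op (a.unop * x) • m)
    rw [← mul_smul]
    rfl

theorem DA.lift_apply {M : Type u} [AddCommGroup M] [Module R M] [Module Aᵐᵒᵖ M]
    [IsScalarTower R Aᵐᵒᵖ M] (φ : M →ₗ[R] injectiveEnvelope R (R ⧸ Ring.jacobson R)) (m : M)
    (x : A) : (show A →ₗ[R] injectiveEnvelope R (R ⧸ Ring.jacobson R) from DA.lift (A := A) φ m) x =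
      φ (MulOpposite.op x • m) := rfl

variable (R A)

/-- By adjunction `Hom_A(X, DA) = Hom_R(X, J)`, with evaluation at `1` inverse to `DA.lift`;
injectivity of `J` therefore transfers. -/
theorem DA.injective : Module.Injective Aᵐᵒᵖ (DA R A) := by
  obtain ⟨ι, hι⟩ := injectiveEnvelope_spec (S := R) (R ⧸ Ring.jacobson R)
  refine ⟨fun X Y _ _ _ _ f hf h => ?_⟩
  let : Module R X := Module.compHom X (algebraMap R Aᵐᵒᵖ)
  let : Module R Y := Module.compHom Y (algebraMap R Aᵐᵒᵖ)
  have : IsScalarTower R Aᵐᵒᵖ X := IsScalarTower.of_algebraMap_smul fun _ _ => rfl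
  have : IsScalarTower R Aᵐᵒᵖ Y := IsScalarTower.of_algebraMap_smul fun _ _ => rfl
  let ev : DA R A →ₗ[R] injectiveEnvelope R (R ⧸ Ring.jacobson R) :=
    LinearMap.applyₗ (R := R) (M₂ := injectiveEnvelope R (R ⧸ Ring.jacobson R)) (1 : A)
  obtain ⟨φ, hφ⟩ := hι.injective_module.out (f.restrictScalars R) hf (ev ∘ₗ h.restrictScalars R)
  refine ⟨DA.lift φ, fun x => LinearMap.ext fun a => ?_⟩
  rw [DA.lift_apply, ← map_smul]
  refine (hφ _).trans ?_
  change (show A →ₗ[R] injectiveEnvelope R (R ⧸ Ring.jacobson R) from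
    h (MulOpposite.op a • x)) 1 = _
  rw [map_smul, DA.op_smul_apply]
  exact congrArg _ (mul_one a)

theorem DA.finite [IsArtinianRing R] [Module.Finite R A] : Module.Finite R (DA R A) := by
  have := isNoetherian_injectiveEnvelope (R := R)
  have : IsNoetherian R (A →ₗ[R] injectiveEnvelope R (R ⧸ Ring.jacobson R)) := inferInstance
  exact inferInstanceAs (Module.Finite R (A →ₗ[R] injectiveEnvelope R (R ⧸ Ring.jacobson R)))

/-- The same adjunction carries over the cogenerator property of `J`: a map to `J` nonzero at `m`
lifts to a map to `DA` nonzero at `m`. -/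
theorem DA.inCogen [IsArtinianRing R] (M : ModuleCat.{u} Aᵐᵒᵖ) [IsArtinian Aᵐᵒᵖ M] :
    InCogen (S := Aᵐᵒᵖ) (DA R A) M := by
  let : Module R M := Module.compHom M (algebraMap R Aᵐᵒᵖ)
  have : IsScalarTower R Aᵐᵒᵖ M := IsScalarTower.of_algebraMap_smul fun _ _ => rfl
  refine inCogen_of_separated fun m hm => ?_
  obtain ⟨φ, hφ⟩ := exists_apply_ne_zero_injectiveEnvelope (R := R) m hm
  refine ⟨DA.lift φ, fun h => hφ ?_⟩
  have h1 := congr((show A →ₗ[R] injectiveEnvelope R (R ⧸ Ring.jacobson R) from $h) 1)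
  rw [DA.lift_apply, MulOpposite.op_one, one_smul] at h1
  exact h1

theorem finite_op [Module.Finite R A] : Module.Finite R Aᵐᵒᵖ :=
  Module.Finite.equiv (MulOpposite.opLinearEquiv R : A ≃ₗ[R] Aᵐᵒᵖ)

theorem isNoetherianRing_op [IsNoetherianRing R] [Module.Finite R A] : IsNoetherianRing Aᵐᵒᵖ :=
  have := finite_op R A
  isNoetherian_of_tower R inferInstance

theorem isArtinianRing_op [IsArtinianRing R] [Module.Finite R A] : IsArtinianRing Aᵐᵒᵖ :=
  have := finite_op R A
  isArtinian_of_tower R inferInstance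

/-- The regular right module as a left module over the opposite ring. -/
def regularEquiv : A ≃ₗ[Aᵐᵒᵖ] Aᵐᵒᵖ :=
  { MulOpposite.opAddEquiv with map_smul' := fun _ _ => rfl }

theorem exists_approximation_of_finite [IsNoetherianRing R] [Module.Finite R A] {Q : Type u}
    [AddCommGroup Q] [Module Aᵐᵒᵖ Q] [Module R Q] [IsScalarTower R Aᵐᵒᵖ Q] [Module.Finite R Q]
    (M : ModuleCat.{u} Aᵐᵒᵖ) (hM : Module.Finite Aᵐᵒᵖ M) :
    ∃ (k : ℕ) (f : (Fin k → Q) →ₗ[Aᵐᵒᵖ] M),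
      ∀ g : Q →ₗ[Aᵐᵒᵖ] M, ∃ h : Q →ₗ[Aᵐᵒᵖ] (Fin k → Q), f ∘ₗ h = g := by
  let : Module R M := Module.compHom M (algebraMap R Aᵐᵒᵖ)
  have : IsScalarTower R Aᵐᵒᵖ M := IsScalarTower.of_algebraMap_smul fun _ _ => rfl
  have := finite_op R A
  have : Module.Finite R M := Module.Finite.trans Aᵐᵒᵖ M
  exact exists_approximation (R := R)

variable [IsArtinianRing R] [Module.Finite R A]

theorem DA.inCogen_of_finite (M : ModuleCat.{u} Aᵐᵒᵖ) (hM : Module.Finite Aᵐᵒᵖ M) :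
    InCogen (S := Aᵐᵒᵖ) (DA R A) M := by
  have := isArtinianRing_op R A
  exact DA.inCogen R A M

/-- If the indecomposable modules have short approximations, then `A` is
representation-hereditary. -/
theorem isRepresentationHereditary_of_hasShortApproximation
    (hA : ∃ M : ModuleCat.{u} Aᵐᵒᵖ, Module.Finite Aᵐᵒᵖ M ∧
      ¬ InAdd (S := Aᵐᵒᵖ) (A × DA R A) M)
    (h : ∀ M : ModuleCat.{u} Aᵐᵒᵖ, IsInd M →
      HasShortApproximation (S := Aᵐᵒᵖ) (A × DA R A) M) :
    IsRepresentationHereditary R A := by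
  have hSA := isArtinianRing_op R A
  have hSN := isNoetherianRing_op R A
  have hDA := DA.finite R A
  have hGS : Module.Finite Aᵐᵒᵖ (A × DA R A) :=
    Module.Finite.of_restrictScalars_finite R Aᵐᵒᵖ (A × DA R A)
  have hEN : IsNoetherianRing (Module.End Aᵐᵒᵖ (A × DA R A))ᵐᵒᵖ :=
    isNoetherianRing_end_op (R := R)
  refine le_antisymm (globalDimension_le_three ?_) ?_
  · refine induction_on_indecomposables ?_ ?_ ?_
    · intro M hM
      have := HomMod.categoryProjective (inAdd_of_subsingleton (M := A × DA R A) (S := Aᵐᵒᵖ) (L := M))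
      exact hasProjectiveDimensionLT_of_ge _ 1 2 (by simp)
    · intro M hM
      obtain ⟨X, g, hX, hK, hg⟩ := h M hM
      exact HomMod.hasProjectiveDimensionLE_one g hX hK hg
    · intro M Y Z e hY hZ
      exact HomMod.hasProjectiveDimensionLE_prod e 1 hY hZ
  · obtain ⟨M, hMf, hM⟩ := hA
    obtain ⟨k, p, hp⟩ := exists_approximation_of_finite R A (Q := A × DA R A) M hMf
    obtain ⟨a, f, hf⟩ := DA.inCogen_of_finite R A M hMf
    have hDS : Module.Finite Aᵐᵒᵖ (DA R A) :=
      Module.Finite.of_restrictScalars_finite R Aᵐᵒᵖ (DA R A)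
    -- Embedding the cokernel as well yields the copresentation `0 → M → DAᵃ → DAᵇ`.
    obtain ⟨b, g, hg⟩ := DA.inCogen_of_finite R A
      (ModuleCat.of Aᵐᵒᵖ ((Fin a → DA R A) ⧸ LinearMap.range f)) inferInstance
    refine three_le_globalDimension
      (LinearMap.inl Aᵐᵒᵖ A (DA R A) ∘ₗ (regularEquiv A).symm.toLinearMap)
      ((regularEquiv A).toLinearMap ∘ₗ LinearMap.fst Aᵐᵒᵖ A (DA R A)) ?_ hM p hp f
      (g ∘ₗ (LinearMap.range f).mkQ) hf ?_
      (inAdd_pi (Fin a) (LinearEquiv.refl Aᵐᵒᵖ (Fin a → DA R A))).prod_right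
      (inAdd_pi (Fin b) (LinearEquiv.refl Aᵐᵒᵖ (Fin b → DA R A))).prod_right
    · refine LinearMap.ext fun x => ?_
      simp
    · exact (LinearMap.exact_map_mkQ_range f).comp_injective g hg (map_zero g)

end Dual

end ArtinAlg

theorem theorem5p3 (R A : Type u) [CommRing R] [IsArtinianRing R] [Ring A] [Algebra R A]
    [Module.Finite R A]
    -- `mod A ≠ add (A ⊕ DA)`
    (hA : ∃ M : ModuleCat.{u} Aᵐᵒᵖ, Module.Finite Aᵐᵒᵖ M ∧
      ¬ InAdd (S := Aᵐᵒᵖ) (A × DA R A) M) :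
    -- conditions (b.1), (b.2), (b.3)
    (((∀ M : ModuleCat.{u} Aᵐᵒᵖ, IsInd M → Subsingleton (M →ₗ[Aᵐᵒᵖ] A) →
          HasInjectiveDimensionLE M 1) ∧
      (∀ M : ModuleCat.{u} Aᵐᵒᵖ, IsInd M → ¬ HasProjectiveDimensionLE M 1 →
          InAdd (S := Aᵐᵒᵖ) (DA R A) M) ∧
      (∀ M : ModuleCat.{u} Aᵐᵒᵖ, IsInd M → Nontrivial (M →ₗ[Aᵐᵒᵖ] A) →
          ¬ InAdd (S := Aᵐᵒᵖ) (DA R A) M → InCogen (S := Aᵐᵒᵖ) A M)) →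
      IsRepresentationHereditary R A) ∧
    -- conditions (a.1), (a.2), (a.3)
    (((∀ M : ModuleCat.{u} Aᵐᵒᵖ, IsInd M → Subsingleton (DA R A →ₗ[Aᵐᵒᵖ] M) →
          HasProjectiveDimensionLE M 1) ∧
      (∀ M : ModuleCat.{u} Aᵐᵒᵖ, IsInd M → Nontrivial (DA R A →ₗ[Aᵐᵒᵖ] M) →
          ¬ InAdd (S := Aᵐᵒᵖ) A M → InGen (S := Aᵐᵒᵖ) (DA R A) M) ∧
      (∀ M : ModuleCat.{u} Aᵐᵒᵖ, IsInd M → ¬ HasInjectiveDimensionLE M 1 →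
          InAdd (S := Aᵐᵒᵖ) A M)) →
      IsRepresentationHereditary R A) := by
  have hSA := isArtinianRing_op R A
  have hSN := isNoetherianRing_op R A
  have hDA := DA.finite R A
  have hDS : Module.Finite Aᵐᵒᵖ (DA R A) :=
    Module.Finite.of_restrictScalars_finite R Aᵐᵒᵖ (DA R A)
  refine ⟨fun ⟨h1, h2, h3⟩ => ?_, fun ⟨h1, h2, h3⟩ => ?_⟩ <;>
    refine isRepresentationHereditary_of_hasShortApproximation R A hA ?_
  · exact hasShortApproximation_of_cogen (regularEquiv A) (DA.injective R A)
      (DA.inCogen_of_finite R A) (exists_approximation_of_finite R A) h1 h2 h3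
  · exact hasShortApproximation_of_gen (regularEquiv A) (DA.injective R A)
      (DA.inCogen_of_finite R A) (exists_approximation_of_finite R A) h1 h2 h3
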